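/- Let $s\ge 2$ be an integer and $n=(2^{2s}+1)(2^s-1)$. Let $\alpha$ be a primitive element of $\mathrm{GF}(2^{4s})$ (a generator of its multiplicative group) and put $\beta=\alpha^{2^s+1}$, a primitive $n$-th root of unity. Let $\mathcal C=\mathcal C_{(2,n,3,1)}$ be the binary BCH code of length $n$ and designed distance $3$, that is, the cyclic code of length $n$ over $\mathrm{GF}(2)$ whose generator polynomial is the least common multiple of the minimal polynomials of $\beta$ and $\beta^2$ over $\mathrm{GF}(2)$. (A word $(c_0,\dots,c_{n-1})\in\mathrm{GF}(2)^n$ is identified with the class of $\sum_i c_ix^i$ in $\mathrm{GF}(2)[x]/\langle x^n-1\rangle$, and the cyclic code generated by $g$ is the ideal generated by $g$.) Let $\mathcal C^\perp=\{b\in\mathrm{GF}(2)^n:\sum_i b_ic_i=0\ \text{for all}\ c\in\mathcal C\}$ be its Euclidean dual. An $[n,k,d]$ code is a $k$-dimensional linear subspace of $\mathrm{GF}(2)^n$ with minimum Hamming distance exactly $d$. Then $\mathcal C$ is an $[n,\,n-4s,\,3]$ code, and $\mathcal C^\perp$ is an $[n,\,4s,\,2^{3s-1}-2^{2s-1}]$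 code. Moreover $\mathcal C^\perp$ is a two-weight code (its nonzero codewords have exactly two distinct Hamming weights), and its weight enumerator $\sum_{j=0}^n A_j z^j$, where $A_j$ is the number of codewords of Hamming weight $j$, is $$1+(2^{4s}-1-n)\,z^{2^{3s-1}-2^{2s-1}}+n\,z^{2^{3s-1}}.$$ -/

import Mathlib

open Polynomial

noncomputable section

/-- The coset of `c₀ + c₁ x + ⋯ + c_{n-1} x^{n-1}` in `F[x]/⟨xⁿ - 1⟩`, for a word `c ∈ Fⁿ`. -/
def wordClass (F : Type*) [Field F] (n : ℕ) :
    (Fin n → F) →ₗ[F] F[X] ⧸ Ideal.span {(X ^ n - 1 : F[X])} where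
  toFun c := Ideal.Quotient.mk _ (∑ i : Fin n, C (c i) * X ^ (i : ℕ))
  map_add' b c := by
    rw [← map_add]
    simp [add_mul, Finset.sum_add_distrib]
  map_smul' a c := by
    have h : (∑ i : Fin n, C ((a • c) i) * X ^ (i : ℕ) : F[X])
        = a • ∑ i : Fin n, C (c i) * X ^ (i : ℕ) := by
      simp [Finset.smul_sum, smul_eq_C_mul, mul_assoc]
    rw [h]
    rfl

/-- The cyclic code of length `n` generated by `g`: the words whose class in `F[x]/⟨xⁿ - 1⟩` lies
in the principal ideal generated by the class of `g`. -/
def cyclicCode {F : Type*} [Field F] (n : ℕ) (g : F[X]) : Submodule F (Fin n → F) :=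
  ((Ideal.span {Ideal.Quotient.mk (Ideal.span {(X ^ n - 1 : F[X])}) g}).restrictScalars F).comap
    (wordClass F n)

open scoped Classical in
/-- The (monic) least common multiple in `F[x]` of the minimal polynomials over `F` of
`β^b, β^(b+1), …, β^(b+δ-2)`. -/
def bchGenerator (F : Type*) {K : Type*} [Field F] [Field K] [Algebra F K]
    (β : K) (δ : ℕ) (b : ℤ) : F[X] :=
  (Finset.range (δ - 1)).lcm fun i => minpoly F (β ^ (b + (i : ℤ)))

/-- The BCH code over `F` of length `n` and designed distance `δ` with starting exponent `b`,
with respect to `β` (a primitive `n`-th root of unity in an extension `K` of `F`). -/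
def bchCode (F : Type*) {K : Type*} [Field F] [Field K] [Algebra F K]
    (β : K) (n δ : ℕ) (b : ℤ) : Submodule F (Fin n → F) :=
  cyclicCode n (bchGenerator F β δ b)

/-- The Euclidean dual code. -/
def dualCode {F : Type*} [Field F] {n : ℕ} (𝒞 : Submodule F (Fin n → F)) :
    Submodule F (Fin n → F) where
  carrier := {b | ∀ c ∈ 𝒞, ∑ i, b i * c i = 0}
  add_mem' {a b} ha hb c hc := by
    simp [add_mul, Finset.sum_add_distrib, ha c hc, hb c hc]
  zero_mem' c _ := by simp
  smul_mem' a b hb c hc := by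
    simp [mul_assoc, ← Finset.mul_sum, hb c hc]

/-- `𝒞` is an `[n, k, d]` linear code: it has dimension `k`, and `d` is the minimum of the Hamming
distances of two distinct codewords. -/
structure IsLinearCode {F : Type*} [Field F] [DecidableEq F] {n : ℕ}
    (𝒞 : Submodule F (Fin n → F)) (k d : ℕ) : Prop where
  finrank_eq : Module.finrank F 𝒞 = k
  isLeast_dist : IsLeast {e : ℕ | ∃ x ∈ 𝒞, ∃ y ∈ 𝒞, x ≠ y ∧ hammingDist x y = e} d

/-- `A_j(𝒞)`, the number of codewords of Hamming weight `j`. -/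
def weightCount {F : Type*} [Field F] [DecidableEq F] {n : ℕ}
    (𝒞 : Submodule F (Fin n → F)) (j : ℕ) : ℕ :=
  {c : Fin n → F | c ∈ 𝒞 ∧ hammingNorm c = j}.ncard

/-- The weight enumerator `∑_{j=0}^n A_j(𝒞) z^j`. -/
def weightEnumerator {F : Type*} [Field F] [DecidableEq F] {n : ℕ}
    (𝒞 : Submodule F (Fin n → F)) : ℤ[X] :=
  ∑ j ∈ Finset.range (n + 1), C (weightCount 𝒞 j : ℤ) * X ^ j

/-- The nonzero codewords of `𝒞` have exactly two distinct Hamming weights. -/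
def IsTwoWeightCode {F : Type*} [Field F] [DecidableEq F] {n : ℕ}
    (𝒞 : Submodule F (Fin n → F)) : Prop :=
  {w : ℕ | ∃ c ∈ 𝒞, c ≠ 0 ∧ hammingNorm c = w}.ncard = 2

end

/-!
Write `q = 2 ^ s`, so that `K = GF(q ^ 4)`, `n = (q ^ 2 + 1) (q - 1)` and `q ^ 4 - 1 = (q + 1) n`.
Since `β` and `β ^ 2` are conjugate, the code is the kernel of `c ↦ ∑ c_i β ^ i`
(`bchCode_eq_ker`), and by trace duality its dual consists of the words `(Tr (a β ^ i))_i` with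
`a` in `K` (`dualCode_ker_evalWord`).

The map `x ↦ x ^ (q + 1)` covers each power of `β` exactly `q + 1` times, so the weight `w` of
such a word is determined by `S = ∑ (-1) ^ Tr (a x ^ (q + 1)) = 1 + (q + 1) (n - 2 w)`
(`hermitianSum_eq`). Here `x ↦ Tr (a x ^ (q + 1))` is a quadratic form over `GF(2)` that vanishes
on the radical of its polar form, whence `S ^ 2 = q ^ 4 |Rad|` (`hermitianSum_sq`). For nonzero
`a`, the radical has order `q ^ 2` if `a ^ n = 1` (`card_polarRadical`) and is trivial otherwise
(`polarRadical_eq_singleton`). The congruence `S ≡ 1` modulo `q + 1` fixes the sign: `S = -q ^ 3`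
in the first case and `S = q ^ 2` in the second. This gives the two weights, the first case being
that of the `n` powers of `β`. Both being nonzero, `a ↦ (Tr (a β ^ i))_i` is injective, which
gives both dimensions.

The code has no word of weight `1` or `2`, because the powers of `β` are nonzero and distinct. It
has one of weight `3`, because `GF(q)ˣ` consists of powers of `β` and contains three distinct
elements `1`, `γ`, `1 + γ` as soon as `q ≥ 4`.
-/

/-! ### Sums over periods -/

lemma sum_range_mul_of_periodic {M : Type*} [AddCommMonoid M] {f : ℕ → M} {k : ℕ}
    (hf : ∀ i, f (i + k) = f i) (m : ℕ) :
    ∑ i ∈ Finset.range (m * k), f i = m • ∑ i ∈ Finset.range k, f i := by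
  have hshift : ∀ m i, f (m * k + i) = f i := by
    intro m
    induction m with
    | zero => simp
    | succ m ih => intro i; rw [← ih i, ← hf (m * k + i)]; congr 1; ring
  induction m with
  | zero => simp
  | succ m ih =>
    rw [Nat.succ_mul, Finset.sum_range_add, ih, succ_nsmul]
    simp [hshift]

/-- A sum over a finite field, by means of a generator of its multiplicative group. -/
lemma sum_eq_zero_add_sum_pow {K M : Type*} [Field K] [Fintype K] [AddCommMonoid M] {α : K} {N : ℕ}
    (hα : IsPrimitiveRoot α N) (hN : Fintype.card K = N + 1) (f : K → M) :
    ∑ x, f x = f 0 + ∑ j ∈ Finset.range N, f (α ^ j) := by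
  classical
  have h0 : N ≠ 0 := by
    rintro rfl
    have := Fintype.one_lt_card (α := K)
    omega
  have hinj : Set.InjOn (fun j => α ^ j) (Finset.range N : Set ℕ) := fun i hi j hj hij =>
    hα.pow_inj (by simpa using hi) (by simpa using hj) hij
  have himg : (Finset.range N).image (fun j => α ^ j) = Finset.univ.erase 0 := by
    refine Finset.eq_of_subset_of_card_le ?_ ?_
    · intro x hx
      obtain ⟨j, -, rfl⟩ := Finset.mem_image.1 hx
      simp [hα.ne_zero h0]
    · rw [Finset.card_image_of_injOn hinj, Finset.card_erase_of_mem (Finset.mem_univ _),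
        Finset.card_univ, hN, Finset.card_range]
      simp
  rw [← Finset.add_sum_erase _ _ (Finset.mem_univ (0 : K)), ← himg, Finset.sum_image hinj]

/-! ### The sign character and the trace -/

/-- The nontrivial additive character `t ↦ (-1) ^ t` of `GF(2)`, with values in `ℤ`. -/
def signChar (t : ZMod 2) : ℤ := if t = 0 then 1 else -1

@[simp] lemma signChar_zero : signChar 0 = 1 := rfl

lemma signChar_add (a b : ZMod 2) : signChar (a + b) = signChar a * signChar b := by
  revert a b; decide

lemma sum_signChar_eq {n : ℕ} (c : Fin n → ZMod 2) :
    ∑ i, signChar (c i) = n - 2 * hammingNorm c := by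
  have h : ∀ t : ZMod 2, signChar t = 1 - 2 * (if t ≠ 0 then 1 else 0) := by decide
  simp_rw [h, Finset.sum_sub_distrib, ← Finset.mul_sum, Finset.sum_boole, hammingNorm]
  simp

open scoped Classical in
/-- The radical of the polar form of `x ↦ Tr (a x ^ (2 ^ s + 1))`. -/
noncomputable def polarRadical {K : Type*} [Field K] [Fintype K] (s : ℕ) (a : K) : Finset K :=
  {u | a * u + a ^ 2 ^ s * u ^ 2 ^ (2 * s) = 0}

lemma mem_polarRadical {K : Type*} [Field K] [Fintype K] {s : ℕ} {a u : K} :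
    u ∈ polarRadical s a ↔ a * u + a ^ 2 ^ s * u ^ 2 ^ (2 * s) = 0 := by
  simp [polarRadical]

section Trace

variable {K : Type*} [Field K] [Fintype K] [Algebra (ZMod 2) K]

lemma trace_pow_two_pow (s : ℕ) (x : K) :
    Algebra.trace (ZMod 2) K (x ^ 2 ^ s) = Algebra.trace (ZMod 2) K x := by
  have h := Algebra.trace_eq_of_algEquiv
    ((FiniteField.frobeniusAlgEquivOfAlgebraic (ZMod 2) K) ^ s) x
  rw [AlgEquiv.coe_pow, FiniteField.coe_frobeniusAlgEquivOfAlgebraic_iterate, ZMod.card] at h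
  exact h

/-- Every linear functional on a finite field is a trace form. -/
lemma exists_eq_trace_mul (φ : K →ₗ[ZMod 2] ZMod 2) :
    ∃ a, ∀ x, φ x = Algebra.trace (ZMod 2) K (a * x) := by
  have h := traceForm_nondegenerate (ZMod 2) K
  refine ⟨((Algebra.traceForm (ZMod 2) K).toDual h).symm φ, fun x => ?_⟩
  rw [← Algebra.traceForm_apply, LinearMap.BilinForm.apply_toDual_symm_apply]

/-- The trace of an element of the subfield `GF(2 ^ s)` vanishes when the degree of the extension
over that subfield is even. -/
lemma trace_eq_zero_of_pow_eq_self {s m : ℕ} (hK : Module.finrank (ZMod 2) K = 2 * m * s) {w : K}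
    (hw : w ^ 2 ^ s = w) : Algebra.trace (ZMod 2) K w = 0 := by
  apply FaithfulSMul.algebraMap_injective (ZMod 2) K
  have := charP_of_injective_algebraMap (algebraMap (ZMod 2) K).injective 2
  rw [FiniteField.algebraMap_trace_eq_sum_pow, hK, map_zero, sum_range_mul_of_periodic, mul_smul,
    two_smul, CharTwo.add_self_eq_zero]
  intro i
  rw [Nat.card_zmod, pow_add, mul_comm, pow_mul, hw]

open scoped Classical in
/-- Orthogonality of the additive characters of a finite field. -/
lemma sum_signChar_trace_mul (c : K) :
    ∑ x, signChar (Algebra.trace (ZMod 2) K (c * x)) = if c = 0 then (Fintype.card K : ℤ) else 0 := by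
  split_ifs with hc
  · simp [hc]
  · obtain ⟨t, ht⟩ := Algebra.trace_surjective (ZMod 2) K 1
    have hne := Equiv.sum_comp (Equiv.addLeft (c⁻¹ * t))
      fun x => signChar (Algebra.trace (ZMod 2) K (c * x))
    simp only [Equiv.coe_addLeft, mul_add, mul_inv_cancel_left₀ hc, map_add, ht, signChar_add,
      ← Finset.mul_sum, show signChar 1 = -1 from rfl] at hne
    linarith

/-! ### The exponential sum of the Hermitian-type form `x ↦ Tr (a x ^ (q + 1))` -/

/-- The exponential sum `∑ (-1) ^ Tr (a x ^ (2 ^ s + 1))`, over all `x` in `K`. -/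
noncomputable def hermitianSum (s : ℕ) (a : K) : ℤ :=
  ∑ x, signChar (Algebra.trace (ZMod 2) K (a * x ^ (2 ^ s + 1)))

/-- The polar form of `x ↦ Tr (a x ^ (2 ^ s + 1))`, written as a trace form in `x ^ 2 ^ s`. -/
lemma trace_form_add (s : ℕ) (a x u : K) :
    Algebra.trace (ZMod 2) K (a * x ^ (2 ^ s + 1))
        + Algebra.trace (ZMod 2) K (a * (u + x) ^ (2 ^ s + 1)) =
      Algebra.trace (ZMod 2) K (a * u ^ (2 ^ s + 1)) +
        Algebra.trace (ZMod 2) K ((a * u + a ^ 2 ^ s * u ^ 2 ^ (2 * s)) * x ^ 2 ^ s) := by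
  have := charP_of_injective_algebraMap (algebraMap (ZMod 2) K).injective 2
  have h1 : a * (u + x) ^ (2 ^ s + 1) = a * u ^ (2 ^ s + 1) + a * x ^ (2 ^ s + 1)
      + a * u * x ^ 2 ^ s + a * u ^ 2 ^ s * x := by
    rw [pow_succ, add_pow_char_pow]; ring
  have h2 : (a * u + a ^ 2 ^ s * u ^ 2 ^ (2 * s)) * x ^ 2 ^ s
      = a * u * x ^ 2 ^ s + (a * u ^ 2 ^ s * x) ^ 2 ^ s := by
    rw [mul_pow, mul_pow, ← pow_mul, ← pow_add, two_mul]; ring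
  rw [h1, h2]
  simp only [map_add, trace_pow_two_pow]
  have h3 := CharTwo.add_self_eq_zero (Algebra.trace (ZMod 2) K (a * x ^ (2 ^ s + 1)))
  linear_combination h3

/-- If `u` lies in the radical of the polar form of `x ↦ Tr (a x ^ (2 ^ s + 1))`, then
`a u ^ (2 ^ s + 1)` lies in `GF(2 ^ s)`. -/
lemma pow_eq_self_of_mem_polarRadical {s : ℕ} {a u : K} (hu : u ∈ polarRadical s a) :
    (a * u ^ (2 ^ s + 1)) ^ 2 ^ s = a * u ^ (2 ^ s + 1) := by
  have := charP_of_injective_algebraMap (algebraMap (ZMod 2) K).injective 2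
  have h := CharTwo.add_eq_zero.1 (mem_polarRadical.1 hu)
  calc (a * u ^ (2 ^ s + 1)) ^ 2 ^ s = a ^ 2 ^ s * u ^ 2 ^ (2 * s) * u ^ 2 ^ s := by
        rw [mul_pow, ← pow_mul, two_mul, pow_add 2 s s, mul_assoc, ← pow_add]; ring_nf
    _ = a * u ^ (2 ^ s + 1) := by rw [← h]; ring

lemma trace_form_eq_zero_of_mem_polarRadical {s : ℕ} (hK : Module.finrank (ZMod 2) K = 4 * s)
    {a u : K} (hu : u ∈ polarRadical s a) :
    Algebra.trace (ZMod 2) K (a * u ^ (2 ^ s + 1)) = 0 :=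
  trace_eq_zero_of_pow_eq_self (m := 2) (s := s) (by rw [hK]) (pow_eq_self_of_mem_polarRadical hu)

/-- The form `x ↦ Tr (a x ^ (2 ^ s + 1))` vanishes on the radical of its polar form, so the square
of its exponential sum is the product of the orders of the field and of the radical. -/
lemma hermitianSum_sq {s : ℕ} (hK : Module.finrank (ZMod 2) K = 4 * s) (a : K) :
    hermitianSum s a ^ 2 = Fintype.card K * (polarRadical s a).card := by
  classical
  have hfrob : Function.Bijective fun x : K => x ^ 2 ^ s := by
    have := charP_of_injective_algebraMap (algebraMap (ZMod 2) K).injective 2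
    exact bijective_iterateFrobenius K 2 s
  calc hermitianSum s a ^ 2
      = ∑ x, ∑ u, signChar (Algebra.trace (ZMod 2) K (a * x ^ (2 ^ s + 1))) *
          signChar (Algebra.trace (ZMod 2) K (a * (u + x) ^ (2 ^ s + 1))) := by
        rw [sq, hermitianSum, Finset.sum_mul]
        refine Finset.sum_congr rfl fun x _ => ?_
        rw [← Finset.mul_sum]
        congr 1
        exact (Equiv.sum_comp (Equiv.addRight x) fun y =>
          signChar (Algebra.trace (ZMod 2) K (a * y ^ (2 ^ s + 1)))).symm
    _ = ∑ u, signChar (Algebra.trace (ZMod 2) K (a * u ^ (2 ^ s + 1))) *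
          ∑ x, signChar (Algebra.trace (ZMod 2) K
            ((a * u + a ^ 2 ^ s * u ^ 2 ^ (2 * s)) * x ^ 2 ^ s)) := by
        rw [Finset.sum_comm]
        simp_rw [Finset.mul_sum, ← signChar_add, trace_form_add]
    _ = ∑ u, if u ∈ polarRadical s a then (Fintype.card K : ℤ) else 0 := by
        refine Finset.sum_congr rfl fun u _ => ?_
        rw [hfrob.sum_comp fun y => signChar (Algebra.trace (ZMod 2) K
          ((a * u + a ^ 2 ^ s * u ^ 2 ^ (2 * s)) * y)), sum_signChar_trace_mul]
        by_cases hu : u ∈ polarRadical s a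
        · rw [if_pos hu, if_pos (mem_polarRadical.1 hu),
            trace_form_eq_zero_of_mem_polarRadical hK hu, signChar_zero, one_mul]
        · rw [if_neg hu, if_neg (mt mem_polarRadical.2 hu), mul_zero]
    _ = _ := by simp [Finset.sum_ite_mem, mul_comm]

end Trace

/-! ### The order of the radical -/

lemma card_sub_one_eq {s n : ℕ} (hn : n = (2 ^ (2 * s) + 1) * (2 ^ s - 1)) :
    2 ^ (4 * s) - 1 = (2 ^ s + 1) * n := by
  obtain ⟨q, hq⟩ := Nat.exists_eq_add_of_le (Nat.one_le_two_pow (n := s))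
  have h2 : 2 ^ (2 * s) = (1 + q) ^ 2 := by rw [← hq, ← pow_mul, mul_comm]
  have h4 : 2 ^ (4 * s) = (1 + q) ^ 4 := by rw [← hq, ← pow_mul, mul_comm]
  rw [hn, h2, h4, hq, Nat.add_sub_cancel_left, Nat.sub_eq_iff_eq_add (Nat.one_le_pow _ _ (by omega))]
  ring

lemma card_roots_pow_eq_self {K : Type*} [Field K] [Fintype K] [DecidableEq K] {m N : ℕ} {ζ : K}
    (hζ : IsPrimitiveRoot ζ N) (hN : 0 < N) (hm : m = N + 1) :
    (Finset.univ.filter fun v : K => v ^ m = v).card = m := by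
  have h : (Finset.univ.filter fun v : K => v ^ m = v) =
      insert 0 (nthRootsFinset N (1 : K)) := by
    ext v
    rw [Finset.mem_filter, Finset.mem_insert, mem_nthRootsFinset hN, hm, pow_succ]
    by_cases hv : v = 0
    · simp [hv]
    · simp [hv]
  rw [h, Finset.card_insert_of_notMem, hζ.card_nthRootsFinset, hm]
  rw [mem_nthRootsFinset hN, zero_pow hN.ne']
  exact zero_ne_one

section Radical

variable {K : Type*} [Field K] [Fintype K] [Algebra (ZMod 2) K]

lemma polarRadical_eq_singleton {s n : ℕ} (hn : n = (2 ^ (2 * s) + 1) * (2 ^ s - 1))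
    (hcard : Fintype.card K = 2 ^ (4 * s)) {a : K} (ha : a ≠ 0) (han : a ^ n ≠ 1) :
    polarRadical s a = {0} := by
  ext u
  rw [Finset.mem_singleton]
  refine ⟨fun hu => ?_, fun hu => by simp [mem_polarRadical, hu]⟩
  by_contra hu0
  have hw := pow_eq_self_of_mem_polarRadical hu
  set w := a * u ^ (2 ^ s + 1) with hwdef
  have hw0 : w ≠ 0 := by positivity
  have hw1 : w ^ (2 ^ s - 1) = 1 := by
    rw [pow_sub₀ _ hw0 Nat.one_le_two_pow, hw, pow_one, mul_inv_cancel₀ hw0]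
  have hwn : w ^ n = 1 := by rw [hn, mul_comm, pow_mul, hw1, one_pow]
  have hun : u ^ ((2 ^ s + 1) * n) = 1 := by
    rw [← card_sub_one_eq hn, ← hcard, FiniteField.pow_card_sub_one_eq_one u hu0]
  rw [hwdef, mul_pow, ← pow_mul, hun, mul_one] at hwn
  exact han hwn

lemma card_polarRadical {s : ℕ} (hs : s ≠ 0) {α : K} (hα : IsPrimitiveRoot α (2 ^ (4 * s) - 1))
    {b : K} (hb : b ≠ 0) : (polarRadical s (b ^ (2 ^ s + 1))).card = 2 ^ (2 * s) := by
  classical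
  have := charP_of_injective_algebraMap (algebraMap (ZMod 2) K).injective 2
  have h1 : 1 < 2 ^ (2 * s) := Nat.one_lt_two_pow (by omega)
  have hprod : 2 ^ (4 * s) - 1 = (2 ^ (2 * s) + 1) * (2 ^ (2 * s) - 1) := by
    rw [show 4 * s = 2 * s + 2 * s by ring, pow_add]
    exact Nat.mul_self_sub_mul_self_eq _ 1
  have hζ := hα.pow (by rw [hprod]; exact Nat.mul_pos (by omega) (by omega)) hprod
  rw [← card_roots_pow_eq_self hζ (by omega) (by omega : 2 ^ (2 * s) = 2 ^ (2 * s) - 1 + 1)]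
  -- `u ↦ b u` maps the radical onto `GF(2 ^ (2 s))`
  refine Finset.card_bijective (fun u => b * u) (mulLeft_bijective₀ b hb) fun u => ?_
  have hkey : (b ^ (2 ^ s + 1)) * u + (b ^ (2 ^ s + 1)) ^ 2 ^ s * u ^ 2 ^ (2 * s) =
      b ^ 2 ^ s * ((b * u) ^ 2 ^ (2 * s) + b * u) := by
    rw [← pow_mul, mul_pow, two_mul, pow_add 2 s s, add_mul, one_mul, pow_add b]; ring
  rw [mem_polarRadical, hkey, mul_eq_zero, or_iff_right (pow_ne_zero _ hb), CharTwo.add_eq_zero]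
  simp

end Radical

/-! ### Weights of the trace words -/

/-- The word `(Tr (a β ^ i))_{i < n}`, as a linear function of `a`. -/
noncomputable def traceWord {K : Type*} [Field K] [Algebra (ZMod 2) K] (β : K) (n : ℕ) :
    K →ₗ[ZMod 2] (Fin n → ZMod 2) :=
  LinearMap.pi fun i => Algebra.trace (ZMod 2) K ∘ₗ LinearMap.mulRight (ZMod 2) (β ^ (i : ℕ))

@[simp] lemma traceWord_apply {K : Type*} [Field K] [Algebra (ZMod 2) K] (β : K) (n : ℕ)
    (a : K) (i : Fin n) :
    traceWord β n a i = Algebra.trace (ZMod 2) K (a * β ^ (i : ℕ)) := rfl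

/-- The exponential sum `S = 1 + (q + 1) k` with `S ^ 2 = q ^ 4` equals `q ^ 2`: the value `-q ^ 2`
is excluded modulo `q + 1`. -/
lemma eq_sub_one_of_sq_eq {q k : ℤ} (hq : 2 ≤ q) (h : (1 + (q + 1) * k) ^ 2 = q ^ 4) :
    k = q - 1 := by
  rcases sq_eq_sq_iff_eq_or_eq_neg.1 (h.trans (by ring : q ^ 4 = (q ^ 2) ^ 2)) with h | h
  · exact mul_left_cancel₀ (by omega : q + 1 ≠ 0) (by linear_combination h)
  · have := Int.le_of_dvd two_pos (⟨-k - q + 1, by linear_combination h⟩ : q + 1 ∣ 2)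
    omega

/-- The exponential sum `S = 1 + (q + 1) k` with `S ^ 2 = q ^ 6` equals `-q ^ 3`: the value `q ^ 3`
is excluded modulo `q + 1`. -/
lemma eq_neg_of_sq_eq {q k : ℤ} (hq : 2 ≤ q) (h : (1 + (q + 1) * k) ^ 2 = q ^ 6) :
    k = -(q ^ 2 - q + 1) := by
  rcases sq_eq_sq_iff_eq_or_eq_neg.1 (h.trans (by ring : q ^ 6 = (q ^ 3) ^ 2)) with h | h
  · have := Int.le_of_dvd two_pos (⟨q ^ 2 - q + 1 - k, by linear_combination h⟩ : q + 1 ∣ 2)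
    omega
  · exact mul_left_cancel₀ (by omega : q + 1 ≠ 0) (by linear_combination h)

lemma cast_length {s n : ℕ} (hn : n = (2 ^ (2 * s) + 1) * (2 ^ s - 1)) :
    (n : ℤ) = ((2 ^ s) ^ 2 + 1) * (2 ^ s - 1) := by
  rw [hn]
  push_cast [Nat.one_le_two_pow]
  ring

lemma two_mul_two_pow_sub_one {m : ℕ} (hm : m ≠ 0) : (2 : ℤ) * 2 ^ (m - 1) = 2 ^ m :=
  mul_pow_sub_one hm 2

section Weight

variable {K : Type*} [Field K] [Fintype K] [Algebra (ZMod 2) K]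

/-- The map `x ↦ x ^ (2 ^ s + 1)` covers each power of `β` equally often, so the exponential sum
determines the weight of the trace word. -/
lemma hermitianSum_eq {s n : ℕ} (hn : n = (2 ^ (2 * s) + 1) * (2 ^ s - 1))
    (hcard : Fintype.card K = 2 ^ (4 * s)) {α β : K} (hα : IsPrimitiveRoot α (2 ^ (4 * s) - 1))
    (hβ : β = α ^ (2 ^ s + 1)) (a : K) :
    hermitianSum s a = 1 + (2 ^ s + 1) * (n - 2 * hammingNorm (traceWord β n a)) := by
  have hN := card_sub_one_eq hn
  have hβn : β ^ n = 1 := by rw [hβ, ← pow_mul, ← hN, hα.pow_eq_one]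
  have hpow : ∀ j, (α ^ j) ^ (2 ^ s + 1) = β ^ j := fun j => by
    rw [hβ, ← pow_mul, ← pow_mul, mul_comm]
  rw [hermitianSum, sum_eq_zero_add_sum_pow hα (by rw [hcard, Nat.sub_add_cancel Nat.one_le_two_pow]),
    hN, ← sum_signChar_eq]
  simp_rw [hpow]
  rw [sum_range_mul_of_periodic (fun i => by rw [pow_add, hβn, mul_one]), Finset.sum_range]
  simp

lemma hammingNorm_traceWord_of_pow_ne_one {s n : ℕ} (hs : s ≠ 0)
    (hn : n = (2 ^ (2 * s) + 1) * (2 ^ s - 1))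
    (hK : Module.finrank (ZMod 2) K = 4 * s) {α β : K}
    (hα : IsPrimitiveRoot α (2 ^ (4 * s) - 1))
    (hβ : β = α ^ (2 ^ s + 1)) {a : K} (ha : a ≠ 0) (han : a ^ n ≠ 1) :
    hammingNorm (traceWord β n a) = 2 ^ (3 * s - 1) - 2 ^ (2 * s - 1) := by
  have hcard : Fintype.card K = 2 ^ (4 * s) := by
    rw [Module.card_eq_pow_finrank (K := ZMod 2), hK, ZMod.card]
  have hsq := hermitianSum_sq hK a
  have heq := hermitianSum_eq hn hcard hα hβ a
  rw [polarRadical_eq_singleton hn hcard ha han, hcard, Finset.card_singleton] at hsq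
  rw [heq] at hsq
  have hq : (2 : ℤ) ≤ 2 ^ s := le_self_pow₀ (by norm_num) hs
  have hk := eq_sub_one_of_sq_eq hq (hsq.trans (by push_cast; ring))
  rw [cast_length hn] at hk
  have h3 := two_mul_two_pow_sub_one (m := 3 * s) (by omega)
  have h2 := two_mul_two_pow_sub_one (m := 2 * s) (by omega)
  rw [mul_comm _ s, pow_mul] at h2 h3
  refine Nat.eq_sub_of_add_eq (by zify; rw [mul_comm _ s, mul_comm _ s]; linarith)

lemma hammingNorm_traceWord_of_pow_eq_one {s n : ℕ} (hs : s ≠ 0)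
    (hn : n = (2 ^ (2 * s) + 1) * (2 ^ s - 1))
    (hK : Module.finrank (ZMod 2) K = 4 * s) {α β : K}
    (hα : IsPrimitiveRoot α (2 ^ (4 * s) - 1))
    (hβ : β = α ^ (2 ^ s + 1)) {a : K} (han : a ^ n = 1) :
    hammingNorm (traceWord β n a) = 2 ^ (3 * s - 1) := by
  have hcard : Fintype.card K = 2 ^ (4 * s) := by
    rw [Module.card_eq_pow_finrank (K := ZMod 2), hK, ZMod.card]
  have hN := card_sub_one_eq hn
  have hpos : 0 < 2 ^ (4 * s) - 1 := Nat.sub_pos_of_lt (Nat.one_lt_two_pow (by omega))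
  have hβn : IsPrimitiveRoot β n := hβ ▸ hα.pow hpos hN
  have : NeZero n := ⟨by rintro rfl; omega⟩
  obtain ⟨i, -, rfl⟩ := hβn.eq_pow_of_pow_eq_one han
  have hα0 : α ≠ 0 := hα.ne_zero hpos.ne'
  have hsq := hermitianSum_sq hK (β ^ i)
  have heq := hermitianSum_eq hn hcard hα hβ (β ^ i)
  have hbi : β ^ i = (α ^ i) ^ (2 ^ s + 1) := by rw [hβ, ← pow_mul, ← pow_mul, mul_comm]
  rw [heq, hcard, hbi, card_polarRadical hs hα (pow_ne_zero i hα0), ← hbi] at hsq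
  have hq : (2 : ℤ) ≤ 2 ^ s := le_self_pow₀ (by norm_num) hs
  have hk := eq_neg_of_sq_eq hq (hsq.trans (by push_cast; ring))
  rw [cast_length hn] at hk
  have h3 := two_mul_two_pow_sub_one (m := 3 * s) (by omega)
  rw [mul_comm _ s, pow_mul] at h3
  zify
  rw [mul_comm _ s]
  linarith

end Weight

/-! ### Cyclic codes and their check functionals -/

lemma mem_cyclicCode_iff_dvd {F : Type*} [Field F] {n : ℕ} {g : F[X]} (hg : g ∣ X ^ n - 1)
    (c : Fin n → F) : c ∈ cyclicCode n g ↔ g ∣ ∑ i : Fin n, C (c i) * X ^ (i : ℕ) := by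
  change Ideal.Quotient.mk _ (∑ i : Fin n, C (c i) * X ^ (i : ℕ)) ∈ Ideal.span _ ↔ _
  rw [Ideal.mem_span_singleton]
  constructor
  · rintro ⟨r, hr⟩
    obtain ⟨r, rfl⟩ := Ideal.Quotient.mk_surjective r
    rw [← map_mul, Ideal.Quotient.eq, Ideal.mem_span_singleton] at hr
    exact (dvd_sub_left (dvd_mul_right g r)).1 (hg.trans hr)
  · exact map_dvd _

/-- The evaluation map `c ↦ ∑ c_i β ^ i`. -/
def evalWord (F : Type*) {K : Type*} [Field F] [Field K] [Algebra F K] (β : K) (n : ℕ) :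
    (Fin n → F) →ₗ[F] K :=
  Fintype.linearCombination F fun i : Fin n => β ^ (i : ℕ)

lemma evalWord_apply {F K : Type*} [Field F] [Field K] [Algebra F K] (β : K) {n : ℕ}
    (c : Fin n → F) : evalWord F β n c = ∑ i, c i • β ^ (i : ℕ) :=
  Fintype.linearCombination_apply ..

lemma minpoly_sq_eq {K : Type*} [Field K] [Finite K] [Algebra (ZMod 2) K] (β : K) :
    minpoly (ZMod 2) (β ^ 2) = minpoly (ZMod 2) β := by
  have hint : IsIntegral (ZMod 2) β := Algebra.IsIntegral.isIntegral β
  refine (minpoly.eq_of_irreducible_of_monic (minpoly.irreducible hint) ?_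
    (minpoly.monic hint)).symm
  have h := ZMod.expand_card (minpoly (ZMod 2) β) (p := 2)
  rw [← expand_aeval, h, map_pow, minpoly.aeval, zero_pow two_ne_zero]

lemma bchGenerator_dvd_iff {F K : Type*} [Field F] [Field K] [Algebra F K] (β : K) (δ : ℕ) (b : ℤ)
    (p : F[X]) : bchGenerator F β δ b ∣ p ↔ ∀ i < δ - 1, minpoly F (β ^ (b + (i : ℤ))) ∣ p := by
  classical
  rw [bchGenerator, Finset.lcm_dvd_iff]
  simp only [Finset.mem_range]

/-- The narrow-sense binary BCH code of designed distance `3` has the single check `c(β) = 0`, since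
`β` and `β ^ 2` are conjugate. -/
lemma bchCode_eq_ker {K : Type*} [Field K] [Finite K] [Algebra (ZMod 2) K] {β : K} {n : ℕ}
    (hβ : β ^ n = 1) : bchCode (ZMod 2) β n 3 1 = LinearMap.ker (evalWord (ZMod 2) β n) := by
  have hgen : ∀ p, bchGenerator (ZMod 2) β 3 1 ∣ p ↔ aeval β p = 0 := fun p => by
    have h1 : β ^ ((1 : ℤ) + (0 : ℕ)) = β := by simp
    have h2 : β ^ ((1 : ℤ) + (1 : ℕ)) = β ^ 2 := by norm_cast
    rw [bchGenerator_dvd_iff, ← minpoly.dvd_iff]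
    constructor
    · intro h
      simpa only [h1] using h 0 (by norm_num)
    · intro h i hi
      obtain rfl | rfl : i = 0 ∨ i = 1 := by omega
      · rwa [h1]
      · rwa [h2, minpoly_sq_eq]
  ext c
  rw [bchCode, mem_cyclicCode_iff_dvd ((hgen _).2 (by simp [hβ])), hgen, LinearMap.mem_ker,
    evalWord_apply]
  simp [Algebra.smul_def]

/-- The dual of the code with the single check `c(β) = 0` consists of the trace words. -/
lemma dualCode_ker_evalWord {K : Type*} [Field K] [Fintype K] [Algebra (ZMod 2) K] (β : K) (n : ℕ) :
    dualCode (LinearMap.ker (evalWord (ZMod 2) β n)) = LinearMap.range (traceWord β n) := by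
  ext b
  constructor
  · intro hb
    have hmem : Fintype.linearCombination (ZMod 2) b ∈
        LinearMap.range (evalWord (ZMod 2) β n).dualMap := by
      rw [LinearMap.range_dualMap_eq_dualAnnihilator_ker, Submodule.mem_dualAnnihilator]
      intro c hc
      rw [Fintype.linearCombination_apply, ← hb c hc]
      exact Finset.sum_congr rfl fun i _ => mul_comm _ _
    obtain ⟨φ, hφ⟩ := hmem
    obtain ⟨a, ha⟩ := exists_eq_trace_mul φ
    refine ⟨a, funext fun i => ?_⟩
    have h := LinearMap.congr_fun hφ (Pi.single i 1)
    rw [LinearMap.dualMap_apply, evalWord] at h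
    simpa [ha, Fintype.linearCombination_apply_single] using h
  · rintro ⟨a, rfl⟩ c hc
    have h : ∑ i, traceWord β n a i * c i =
        Algebra.trace (ZMod 2) K (a * evalWord (ZMod 2) β n c) := by
      rw [evalWord_apply, Finset.mul_sum, map_sum]
      refine Finset.sum_congr rfl fun i _ => ?_
      rw [mul_smul_comm, map_smul, traceWord_apply, smul_eq_mul, mul_comm]
    rw [h, LinearMap.mem_ker.1 hc, mul_zero, map_zero]

/-- The evaluation map and the trace map are dual to each other under the trace form. -/
lemma evalWord_surjective {K : Type*} [Field K] [Fintype K] [Algebra (ZMod 2) K] {β : K} {n : ℕ}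
    (h : Function.Injective (traceWord β n)) : Function.Surjective (evalWord (ZMod 2) β n) := by
  rw [← LinearMap.dualMap_injective_iff, injective_iff_map_eq_zero]
  intro φ hφ
  obtain ⟨a, ha⟩ := exists_eq_trace_mul φ
  have ha0 : a = 0 := by
    refine (injective_iff_map_eq_zero _).1 h a (funext fun i => ?_)
    have := LinearMap.congr_fun hφ (Pi.single i 1)
    rw [LinearMap.dualMap_apply, evalWord] at this
    simpa [ha, Fintype.linearCombination_apply_single] using this
  ext x
  simp [ha, ha0]

/-! ### Minimum distance and weight enumerator of a linear code -/

lemma isLinearCode_of_isLeast_hammingNorm {F : Type*} [Field F] [DecidableEq F] {n : ℕ}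
    {𝒞 : Submodule F (Fin n → F)} {k d : ℕ} (hk : Module.finrank F 𝒞 = k)
    (hmin : IsLeast {e : ℕ | ∃ x ∈ 𝒞, x ≠ 0 ∧ hammingNorm x = e} d) : IsLinearCode 𝒞 k d := by
  refine ⟨hk, ?_⟩
  convert hmin using 2
  ext e
  constructor
  · rintro ⟨x, hx, y, hy, hxy, rfl⟩
    refine ⟨-x + y, 𝒞.add_mem (𝒞.neg_mem hx) hy, ?_, ?_⟩
    · rwa [Ne, neg_add_eq_zero]
    · rw [hammingDist_eq_hammingNorm]
  · rintro ⟨x, hx, hx0, rfl⟩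
    exact ⟨x, hx, 0, 𝒞.zero_mem, hx0, hammingDist_zero_right x⟩

lemma weightEnumerator_range {F M : Type*} [Field F] [DecidableEq F] [AddCommGroup M] [Module F M]
    [Fintype M] {n : ℕ} {f : M →ₗ[F] (Fin n → F)} (hf : Function.Injective f) :
    weightEnumerator (LinearMap.range f) = ∑ a, X ^ hammingNorm (f a) := by
  have hcount : ∀ j, weightCount (LinearMap.range f) j =
      (Finset.univ.filter fun a => hammingNorm (f a) = j).card := fun j => by
    rw [weightCount, ← Set.ncard_coe_finset, ← Set.ncard_image_of_injective _ hf]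
    congr 1
    ext c
    constructor
    · rintro ⟨⟨a, rfl⟩, h⟩
      exact ⟨a, by simpa using h, rfl⟩
    · rintro ⟨a, h, rfl⟩
      exact ⟨⟨a, rfl⟩, by simpa using h⟩
  rw [← Finset.sum_fiberwise_of_maps_to (t := Finset.range (n + 1))
    (g := fun a => hammingNorm (f a))]
  · refine Finset.sum_congr rfl fun j _ => ?_
    rw [hcount, Finset.sum_congr rfl fun a ha => by rw [(Finset.mem_filter.1 ha).2]]
    simp
  · intro a _
    have := hammingNorm_le_card_fintype (x := f a)
    rw [Fintype.card_fin] at this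
    exact Finset.mem_range.2 (by omega)

/-! ### Minimum distance of the BCH code -/

/-- A nonzero word with `c(β) = 0` has weight at least `3`, the powers of `β` being nonzero and
distinct. -/
lemma three_le_hammingNorm_of_evalWord_eq_zero {K : Type*} [Field K] [Algebra (ZMod 2) K] {β : K}
    {n : ℕ} (hβ : IsPrimitiveRoot β n) {c : Fin n → ZMod 2} (hc : evalWord (ZMod 2) β n c = 0)
    (hc0 : c ≠ 0) : 3 ≤ hammingNorm c := by
  have := charP_of_injective_algebraMap (algebraMap (ZMod 2) K).injective 2
  obtain ⟨i₀, -⟩ := Function.ne_iff.1 hc0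
  have hβ0 : β ≠ 0 := hβ.ne_zero (Fin.pos i₀).ne'
  have hsum : ∑ i ∈ Finset.univ.filter fun i => c i ≠ 0, β ^ (i : ℕ) = 0 := by
    rw [← hc, evalWord_apply, Finset.sum_filter]
    refine Finset.sum_congr rfl fun i _ => ?_
    have h : ∀ t : ZMod 2, t = 0 ∨ t = 1 := by decide
    rcases h (c i) with h | h <;> simp [h]
  have hpos := hammingNorm_pos_iff.2 hc0
  by_contra! hlt
  change 0 < (Finset.univ.filter fun i => c i ≠ 0).card at hpos
  change (Finset.univ.filter fun i => c i ≠ 0).card < 3 at hlt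
  obtain h | h : (Finset.univ.filter fun i => c i ≠ 0).card = 1 ∨
    (Finset.univ.filter fun i => c i ≠ 0).card = 2 := by omega
  · obtain ⟨i, hi⟩ := Finset.card_eq_one.1 h
    rw [hi, Finset.sum_singleton] at hsum
    exact pow_ne_zero _ hβ0 hsum
  · obtain ⟨i, j, hij, hS⟩ := Finset.card_eq_two.1 h
    rw [hS, Finset.sum_pair hij, CharTwo.add_eq_zero] at hsum
    exact hij (Fin.ext (hβ.pow_inj i.2 j.2 hsum))

/-- A word of weight `3`: for `γ` generating `GF(2 ^ s)ˣ`, the elements `1`, `γ` and `1 + γ` are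
three powers of `β` with zero sum. -/
lemma exists_hammingNorm_eq_three {K : Type*} [Field K] [Algebra (ZMod 2) K] {β : K} {s n : ℕ}
    (hs : 2 ≤ s) (hn : n = (2 ^ (2 * s) + 1) * (2 ^ s - 1)) (hβ : IsPrimitiveRoot β n) :
    ∃ c, evalWord (ZMod 2) β n c = 0 ∧ hammingNorm c = 3 := by
  have := charP_of_injective_algebraMap (algebraMap (ZMod 2) K).injective 2
  have hq : 4 ≤ 2 ^ s := Nat.pow_le_pow_right two_pos hs
  set m := 2 ^ (2 * s) + 1
  have hm : 0 < m := Nat.succ_pos _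
  have hγ : IsPrimitiveRoot (β ^ m) (2 ^ s - 1) :=
    hβ.pow (by rw [hn]; exact Nat.mul_pos hm (by omega)) hn
  have hγ1 : β ^ m ≠ 1 := hγ.ne_one (by omega)
  have hγ0 : β ^ m ≠ 0 := hγ.ne_zero (by omega)
  have hsum0 : 1 + β ^ m ≠ 0 := fun h => hγ1 (CharTwo.add_eq_zero.1 h).symm
  have hγq : (β ^ m) ^ 2 ^ s = β ^ m := by
    rw [← Nat.sub_add_cancel (by omega : 1 ≤ 2 ^ s), pow_succ, hγ.pow_eq_one, one_mul]
  have hroot : (1 + β ^ m) ^ (2 ^ s - 1) = 1 := by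
    rw [pow_sub₀ _ hsum0 (by omega), add_pow_char_pow, one_pow, hγq, pow_one,
      mul_inv_cancel₀ hsum0]
  have : NeZero (2 ^ s - 1) := ⟨by omega⟩
  obtain ⟨k, hk, hγk⟩ := hγ.eq_pow_of_pow_eq_one hroot
  have hk0 : k ≠ 0 := by
    rintro rfl
    rw [pow_zero] at hγk
    exact hγ0 (by linear_combination -hγk)
  have hk1 : k ≠ 1 := by
    rintro rfl
    rw [pow_one] at hγk
    exact one_ne_zero (α := K) (by linear_combination -hγk)
  have hlt : ∀ j < 2 ^ s - 1, m * j < n := fun j hj => by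
    rw [hn]; exact Nat.mul_lt_mul_of_pos_left hj hm
  let e : ∀ j < 2 ^ s - 1, Fin n := fun j hj => ⟨m * j, hlt j hj⟩
  have he : ∀ {i j} (hi : i < 2 ^ s - 1) (hj : j < 2 ^ s - 1), i ≠ j → e i hi ≠ e j hj :=
    fun hi hj hij h => hij (Nat.eq_of_mul_eq_mul_left hm (Fin.mk.inj h))
  have h0 : 0 < 2 ^ s - 1 := by omega
  have h1 : 1 < 2 ^ s - 1 := by omega
  classical
  let S : Finset (Fin n) := {e 0 h0, e 1 h1, e k hk}
  refine ⟨fun i => if i ∈ S then 1 else 0, ?_, ?_⟩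
  · rw [evalWord_apply]
    simp only [ite_smul, one_smul, zero_smul, Finset.sum_ite_mem, Finset.univ_inter]
    rw [Finset.sum_insert, Finset.sum_pair (he h1 hk hk1.symm)]
    · simp only [e, mul_zero, mul_one, pow_zero, pow_mul, hγk]
      linear_combination CharTwo.add_self_eq_zero (1 + β ^ m)
    · simp [he h0 h1 zero_ne_one, he h0 hk hk0.symm]
  · rw [hammingNorm, ← Finset.card_eq_three.2
      ⟨_, _, _, he h0 h1 zero_ne_one, he h0 hk hk0.symm, he h1 hk hk1.symm, rfl⟩]
    congr 1
    ext i
    simp only [S, Finset.mem_filter_univ, Finset.mem_insert, Finset.mem_singleton, ne_eq,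
      ite_eq_right_iff, one_ne_zero, imp_false, not_not]

/-! ### Parameters and weights -/

theorem mainTheorem8 (s : ℕ) (hs : 2 ≤ s) (n : ℕ) (hn : n = (2 ^ (2 * s) + 1) * (2 ^ s - 1))
    (K : Type*) [Field K] [Algebra (ZMod 2) K] (hK : Nat.card K = 2 ^ (4 * s))
    (α : K) (hα : IsPrimitiveRoot α (2 ^ (4 * s) - 1))
    (β : K) (hβ : β = α ^ (2 ^ s + 1)) :
    IsLinearCode (bchCode (ZMod 2) β n 3 1) (n - 4 * s) 3 ∧
    IsLinearCode (dualCode (bchCode (ZMod 2) β n 3 1)) (4 * s)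
      (2 ^ (3 * s - 1) - 2 ^ (2 * s - 1)) ∧
    IsTwoWeightCode (dualCode (bchCode (ZMod 2) β n 3 1)) ∧
    weightEnumerator (dualCode (bchCode (ZMod 2) β n 3 1)) =
      1 + Polynomial.C ((2 : ℤ) ^ (4 * s) - 1 - (n : ℤ)) *
          Polynomial.X ^ (2 ^ (3 * s - 1) - 2 ^ (2 * s - 1)) +
        Polynomial.C (n : ℤ) * Polynomial.X ^ (2 ^ (3 * s - 1)) := by
  have : Finite K := Nat.finite_of_card_ne_zero (by rw [hK]; positivity)
  have : Fintype K := Fintype.ofFinite K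
  have hcard : Fintype.card K = 2 ^ (4 * s) := by rw [← hK, Nat.card_eq_fintype_card]
  have hfin : Module.finrank (ZMod 2) K = 4 * s := by
    rw [Module.card_eq_pow_finrank (K := ZMod 2), ZMod.card] at hcard
    exact Nat.pow_right_injective le_rfl hcard
  have hN := card_sub_one_eq hn
  have hpos : 0 < 2 ^ (4 * s) - 1 := Nat.sub_pos_of_lt (Nat.one_lt_two_pow (by omega))
  have hβn : IsPrimitiveRoot β n := hβ ▸ hα.pow hpos hN
  have hn0 : 0 < n := Nat.pos_of_ne_zero (by rintro rfl; omega)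
  set w₁ := 2 ^ (3 * s - 1) - 2 ^ (2 * s - 1) with hw₁
  set w₂ := 2 ^ (3 * s - 1) with hw₂
  have hlt : 2 ^ (2 * s - 1) < 2 ^ (3 * s - 1) := Nat.pow_lt_pow_right one_lt_two (by omega)
  have hw₁0 : 0 < w₁ := by omega
  have hw : w₁ < w₂ := Nat.sub_lt (by positivity) (by positivity)
  have hwt₁ : ∀ a : K, a ≠ 0 → a ^ n ≠ 1 → hammingNorm (traceWord β n a) = w₁ := fun a =>
    hammingNorm_traceWord_of_pow_ne_one (by omega) hn hfin hα hβ
  have hwt₂ : ∀ a : K, a ^ n = 1 → hammingNorm (traceWord β n a) = w₂ := fun a =>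
    hammingNorm_traceWord_of_pow_eq_one (by omega) hn hfin hα hβ
  have hinj : Function.Injective (traceWord β n) := by
    refine (injective_iff_map_eq_zero _).2 fun a ha => ?_
    by_contra ha0
    rw [← hammingNorm_eq_zero] at ha
    by_cases han : a ^ n = 1
    · have := hwt₂ a han; omega
    · have := hwt₁ a ha0 han; omega
  have hα0 : α ≠ 0 := hα.ne_zero hpos.ne'
  have hαn : α ^ n ≠ 1 := by
    refine hα.pow_ne_one_of_pos_of_lt hn0.ne' ?_
    rw [hN]
    exact lt_mul_of_one_lt_left hn0 (by have := Nat.two_pow_pos s; omega)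
  have hne : ∀ a : K, a ≠ 0 → traceWord β n a ≠ 0 := fun a ha h =>
    ha ((injective_iff_map_eq_zero _).1 hinj a h)
  rw [bchCode_eq_ker hβn.pow_eq_one, dualCode_ker_evalWord]
  refine ⟨isLinearCode_of_isLeast_hammingNorm ?_ ⟨?_, ?_⟩,
    isLinearCode_of_isLeast_hammingNorm ?_ ⟨?_, ?_⟩, ?_, ?_⟩
  · have h := LinearMap.finrank_range_add_finrank_ker (evalWord (ZMod 2) β n)
    rw [LinearMap.range_eq_top.2 (evalWord_surjective hinj), finrank_top, hfin,
      Module.finrank_fin_fun] at h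
    omega
  · obtain ⟨c, hc, hc3⟩ := exists_hammingNorm_eq_three hs hn hβn
    exact ⟨c, hc, hammingNorm_ne_zero_iff.1 (by omega), hc3⟩
  · rintro e ⟨c, hc, hc0, rfl⟩
    exact three_le_hammingNorm_of_evalWord_eq_zero hβn hc hc0
  · rw [LinearMap.finrank_range_of_inj hinj, hfin]
  · exact ⟨_, ⟨α, rfl⟩, hne α hα0, hwt₁ α hα0 hαn⟩
  · rintro e ⟨_, ⟨a, rfl⟩, ha, rfl⟩
    have ha0 : a ≠ 0 := fun h => ha (by rw [h, map_zero])
    by_cases han : a ^ n = 1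
    · rw [hwt₂ a han]; exact hw.le
    · rw [hwt₁ a ha0 han]
  · refine (congrArg Set.ncard ?_).trans (Set.ncard_pair hw.ne)
    ext e
    constructor
    · rintro ⟨_, ⟨a, rfl⟩, ha, rfl⟩
      have ha0 : a ≠ 0 := fun h => ha (by rw [h, map_zero])
      by_cases han : a ^ n = 1
      · exact Or.inr (hwt₂ a han)
      · exact Or.inl (hwt₁ a ha0 han)
    · rintro (rfl | rfl)
      · exact ⟨_, ⟨α, rfl⟩, hne α hα0, hwt₁ α hα0 hαn⟩
      · exact ⟨_, ⟨1, rfl⟩, hne 1 one_ne_zero, hwt₂ 1 (one_pow n)⟩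
  · classical
    rw [weightEnumerator_range hinj]
    have hroots : (Finset.univ.filter fun a : K => a ^ n = 1).card = n := by
      refine (congrArg Finset.card ?_).trans hβn.card_nthRootsFinset
      ext a
      simp [mem_nthRootsFinset hn0]
    -- `X ^ wt` as a combination of indicator functions of `a = 0` and of `a ^ n = 1`
    have hterm : ∀ a : K, (X ^ hammingNorm (traceWord β n a) : ℤ[X]) =
        X ^ w₁ + (if a = 0 then 1 - X ^ w₁ else 0) + if a ^ n = 1 then X ^ w₂ - X ^ w₁ else 0 := by
      intro a
      by_cases ha0 : a = 0
      · simp [ha0, hn0.ne']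
      · by_cases han : a ^ n = 1
        · rw [hwt₂ a han, if_neg ha0, if_pos han]; ring
        · rw [hwt₁ a ha0 han, if_neg ha0, if_neg han]; ring
    simp_rw [hterm, Finset.sum_add_distrib, Finset.sum_ite_eq' _ (0 : K), ← Finset.sum_filter,
      Finset.sum_const, hroots, Finset.card_univ, hcard]
    simp
    ring
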